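/- Let $d,n\ge 1$. For a compact convex subset $B$ of a finite-dimensional real vector space let $\partial B=B\setminus ri(B)$, where $ri(B)$ is the interior of $B$ relative to its affine hull, and define the boundariness of $y\in B$ in $B$ as $$b_B(y)=1-\sup\ \max_j\pi_j ,$$ where the supremum is taken over all finite convex decompositions $y=\sum_j\pi_jx_j$ ($\pi_j\ge 0$, $\sum_j\pi_j=1$) with all $x_j\in\partial B$; it is understood to be $0$ if there is no such decomposition, which happens only if $B$ is a single point. Let $\mathcal H_d=\mathbb C^d$. The maximal value of boundariness for quantum convex sets is as follows. 1. States. For the set of density operators on $\mathcal H_d$ (positive operators of unit trace), the maximal value of boundariness is $1/d$, and it is attained at, and only at, the completely mixed state $\frac1d I$. 2. Observables. For the set of $n$-outcome observables on $\mathcal H_d$ ($n$-tuples $(E_1,\dots,E_n)$ of operators with $0\le E_j\le I$ and $\sum_jE_j=I$), the maximal value of boundariness is $1/n$, and it is attained at, and only at, the uniformly trivial observable $E_j=\frac1n I$, $j=1,\dots,n$. 3. Channels. For the set of completely positive trace-preserving linear maps from operators on $\mathcal H_d$ to operators on $\mathcal H_d$, the maximal value of boundariness is $1/d^2$, and it is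 attained at, and only at, the completely depolarizing channel $X\mapsto \mathrm{tr}(X)\,\frac1d I$. -/

import Mathlib

open scoped ComplexOrder

/-- The relative boundary `∂B = B \ ri(B)` of a subset `B` of a real topological vector space:
`ri(B)` is the interior of `B` relative to the affine hull of `B`. -/
def relBoundary {V : Type*} [AddCommGroup V] [Module ℝ V] [TopologicalSpace V]
    (B : Set V) : Set V :=
  B \ intrinsicInterior ℝ B

/-- The maximal weights `max_j π_j` of the finite convex decompositions `y = ∑_j π_j x_j`
of `y` into elements `x_j` of the relative boundary of `B`. -/
def boundaryWeights {V : Type*} [AddCommGroup V] [Module ℝ V] [TopologicalSpace V]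
    (B : Set V) (y : V) : Set ℝ :=
  {w | ∃ (k : ℕ) (π : Fin k → ℝ) (x : Fin k → V),
    (∀ j, 0 ≤ π j) ∧ ∑ j, π j = 1 ∧ (∀ j, x j ∈ relBoundary B) ∧ y = ∑ j, π j • x j ∧
    IsGreatest (Set.range π) w}

/-- The boundariness of `y` in `B`: one minus the supremum of the maximal weights of the
convex decompositions of `y` into boundary elements. (A one-point set has no boundary elements;
the supremum is then `0`, and the boundariness of the point is `1`.) -/
noncomputable def boundariness {V : Type*} [AddCommGroup V] [Module ℝ V] [TopologicalSpace V]
    (B : Set V) (y : V) : ℝ :=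
  1 - sSup (boundaryWeights B y)

/-- Operators on the `d`-dimensional Hilbert space `ℂ^d`. -/
abbrev Op (d : ℕ) : Type := Matrix (Fin d) (Fin d) ℂ

/-- Density operators: positive operators of unit trace. -/
def quantumStates (d : ℕ) : Set (Op d) :=
  {ρ | ρ.PosSemidef ∧ ρ.trace = 1}

/-- Observables with `n` outcomes: collections of effects `0 ≤ E_j ≤ I` with `∑_j E_j = I`. -/
def quantumObservables (d n : ℕ) : Set (Fin n → Op d) :=
  {E | (∀ j, (E j).PosSemidef ∧ (1 - E j).PosSemidef) ∧ ∑ j, E j = 1}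

/-- The map `id_k ⊗ Φ` on operators on `ℂ^k ⊗ ℂ^d`: apply `Φ` to each `d × d` block. -/
noncomputable def ampliation {d : ℕ} (k : ℕ) (Φ : Op d →L[ℂ] Op d)
    (X : Matrix (Fin k × Fin d) (Fin k × Fin d) ℂ) :
    Matrix (Fin k × Fin d) (Fin k × Fin d) ℂ :=
  Matrix.of fun p q => Φ (Matrix.of fun i j => X (p.1, i) (q.1, j)) p.2 q.2

/-- Quantum channels: completely positive trace-preserving linear maps. Linear maps between these
finite-dimensional spaces are automatically continuous; the type of continuous linear maps is used
because it carries the (unique) vector space topology. -/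
def quantumChannels (d : ℕ) : Set (Op d →L[ℂ] Op d) :=
  {Φ | (∀ (k : ℕ) (X : Matrix (Fin k × Fin d) (Fin k × Fin d) ℂ),
        X.PosSemidef → (ampliation k Φ X).PosSemidef) ∧
      ∀ X : Op d, (Φ X).trace = X.trace}

/-- The completely mixed state `I / d`. -/
noncomputable def completelyMixedState (d : ℕ) : Op d :=
  (d : ℂ)⁻¹ • (1 : Op d)

/-- The uniformly trivial observable `E_j = I / n` for all `j`. -/
noncomputable def uniformTrivialObservable (d n : ℕ) : Fin n → Op d :=
  fun _ => (n : ℂ)⁻¹ • (1 : Op d)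

/-- The completely depolarizing channel `X ↦ tr(X) I / d`. -/
noncomputable def completelyDepolarizingChannel (d : ℕ) : Op d →L[ℂ] Op d :=
  LinearMap.toContinuousLinearMap
    ((Matrix.traceLinearMap (Fin d) ℂ ℂ).smulRight (completelyMixedState d))

/-!
The boundariness of `y` is the infimum, over boundary points `x` of `B`, of the largest weight with
which `x` occurs in a decomposition of `y`: pushing the remaining part of the decomposition to the
boundary gives a two-term boundary decomposition.

States, observables and channels are spectrahedra `B = {x ∈ A | 0 ≤ C x}` with `C x ≤ c • 1` and
`tr (C x)` constant on `B`; for channels, `C x` is the Choi matrix. The noisiest element `e`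
satisfies `C e = (c / N) • 1`, so every `x ∈ B` occurs in `e` with weight `1 / N`. It is the uniform
mixture of `N` sharp elements `p a` (basis states, constant outcomes, conjugations by the `d²` Weyl
unitaries) for which `P a := C (p a)` satisfies `P a ^ 2 = c • P a` and `∑ a, P a = c • 1`.
For `N > 1`, isolating one of them decomposes `e` into boundary points with weights `1 / N` and
`1 - 1 / N`, so the boundariness of `e` is `1 / N`.

If the boundariness of `y` is at least `1 / N`, then every `p a` occurs in `y` with weight `1 / N`,
that is, `P a / N ≤ C y`. The nonnegative numbers `tr ((C y - P a / N) * P a)` add up to zero, so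
the products `(C y - P a / N) * P a` all vanish; their sum is `c • (C y - C e)`, and so `y = e`.
-/

section ConvexParts

open Filter Topology

variable {V : Type*} [AddCommGroup V] [Module ℝ V] {B : Set V}

/-- `x` occurs with weight `s` in a convex decomposition of `y` whose remaining part `z` lies in
`B`. For `x` and `y` in `B`, the supremum of these weights is the weight function `t_y(x)` in terms
of which the paper studies boundariness. -/
def OccursWithWeight (B : Set V) (s : ℝ) (x y : V) : Prop :=
  ∃ z ∈ B, s • x + (1 - s) • z = y

theorem OccursWithWeight.mono (hB : Convex ℝ B) {s t : ℝ} {x y : V} (hx : x ∈ B)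
    (hst : s ≤ t) (ht : t < 1) (h : OccursWithWeight B t x y) : OccursWithWeight B s x y := by
  obtain ⟨z, hz, rfl⟩ := h
  have hs1 : 0 < 1 - s := by linarith
  refine ⟨((t - s) / (1 - s)) • x + ((1 - t) / (1 - s)) • z, hB hx hz ?_ ?_ ?_, ?_⟩
  · exact div_nonneg (sub_nonneg.2 hst) hs1.le
  · exact div_nonneg (sub_nonneg.2 ht.le) hs1.le
  · field_simp
    ring
  · match_scalars <;> field_simp
    ring

variable [TopologicalSpace V]

theorem exists_occursWithWeight_of_mem_boundaryWeights (hB : Convex ℝ B) {y : V} {w : ℝ}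
    (hw : w ∈ boundaryWeights B y) : ∃ x ∈ relBoundary B, OccursWithWeight B w x y := by
  obtain ⟨k, π, x, hπ, hπ1, hx, rfl, ⟨j, rfl⟩, -⟩ := hw
  have hrest : ∑ l ∈ Finset.univ.erase j, π l = 1 - π j := by
    rw [← hπ1, ← Finset.add_sum_erase _ _ (Finset.mem_univ j), add_sub_cancel_left]
  rw [← Finset.add_sum_erase _ _ (Finset.mem_univ j)]
  refine ⟨x j, hx j, ?_⟩
  obtain h | h := (hrest ▸ Finset.sum_nonneg fun l _ => hπ l : 0 ≤ 1 - π j).eq_or_lt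
  · have hzero : ∀ l ∈ Finset.univ.erase j, π l = 0 :=
      (Finset.sum_eq_zero_iff_of_nonneg fun l _ => hπ l).1 (hrest.trans h.symm)
    refine ⟨x j, (hx j).1, ?_⟩
    rw [← h, zero_smul, Finset.sum_eq_zero fun l hl => by rw [hzero l hl, zero_smul]]
  · refine ⟨(Finset.univ.erase j).centerMass π x,
      hB.centerMass_mem (fun l _ => hπ l) (hrest ▸ h) fun l _ => (hx l).1, ?_⟩
    rw [Finset.centerMass, hrest, smul_inv_smul₀ h.ne']

theorem max_mem_boundaryWeights {x z : V} {s : ℝ} (hs0 : 0 ≤ s) (hs1 : s ≤ 1)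
    (hx : x ∈ relBoundary B) (hz : z ∈ relBoundary B) :
    max s (1 - s) ∈ boundaryWeights B (s • x + (1 - s) • z) := by
  refine ⟨2, ![s, 1 - s], ![x, z], ?_, by simp, ?_, by simp, ?_⟩
  · simpa [Fin.forall_fin_two] using ⟨hs0, hs1⟩
  · simpa [Fin.forall_fin_two] using ⟨hx, hz⟩
  · rw [Matrix.range_cons, Matrix.range_cons, Matrix.range_empty, Set.union_empty,
      Set.singleton_union]
    exact isGreatest_pair

theorem le_one_of_mem_boundaryWeights {y : V} {w : ℝ} (hw : w ∈ boundaryWeights B y) :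
    w ≤ 1 := by
  obtain ⟨k, π, x, hπ, hπ1, -, -, ⟨j, rfl⟩, -⟩ := hw
  exact hπ1 ▸ Finset.single_le_sum (fun i _ => hπ i) (Finset.mem_univ j)

theorem boundariness_singleton (x : V) : boundariness {x} x = 1 := by
  have hempty : boundaryWeights {x} x = ∅ := by
    refine Set.eq_empty_of_forall_notMem ?_
    rintro _ ⟨k, π, y, -, -, hy, -, ⟨j, -⟩, -⟩
    simpa [relBoundary] using hy j
  rw [boundariness, hempty, Real.sSup_empty, sub_zero]

theorem mem_intrinsicInterior_iff_mem_nhdsWithin {x : V} :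
    x ∈ intrinsicInterior ℝ B ↔ x ∈ affineSpan ℝ B ∧ B ∈ 𝓝[affineSpan ℝ B] x := by
  simp only [mem_intrinsicInterior, mem_interior_iff_mem_nhds]
  constructor
  · rintro ⟨x, hx, rfl⟩
    exact ⟨x.2, preimage_coe_mem_nhds_subtype.1 hx⟩
  · rintro ⟨hx, hxB⟩
    exact ⟨⟨x, hx⟩, preimage_coe_mem_nhds_subtype.2 hxB, rfl⟩

variable [IsTopologicalAddGroup V] [ContinuousSMul ℝ V]

theorem exists_gt_one_lineMap_mem_of_mem_intrinsicInterior {x y : V} (hx : x ∈ B)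
    (hy : y ∈ intrinsicInterior ℝ B) : ∃ t > (1 : ℝ), AffineMap.lineMap x y t ∈ B := by
  obtain ⟨hyA, hyB⟩ := mem_intrinsicInterior_iff_mem_nhdsWithin.1 hy
  have hline : Tendsto (AffineMap.lineMap x y) (𝓝 (1 : ℝ)) (𝓝[affineSpan ℝ B] y) := by
    refine tendsto_nhdsWithin_iff.2 ⟨?_, .of_forall fun t =>
      AffineMap.lineMap_mem t (subset_affineSpan ℝ B hx) hyA⟩
    simpa using (AffineMap.lineMap_continuous (R := ℝ) (p := x) (q := y)).tendsto 1
  have hmem : ∀ᶠ t in 𝓝[>] (1 : ℝ), AffineMap.lineMap x y t ∈ B :=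
    (hline.mono_left nhdsWithin_le_nhds).eventually hyB
  obtain ⟨t, htB, ht⟩ := (hmem.and self_mem_nhdsWithin).exists
  exact ⟨t, ht, htB⟩

theorem mem_relBoundary_of_linearMap_eq_zero (f : V →ₗ[ℝ] ℝ) (hf : ∀ z ∈ B, 0 ≤ f z) {x y : V}
    (hx : x ∈ B) (hy : y ∈ B) (hfx : f x = 0) (hfy : 0 < f y) : x ∈ relBoundary B := by
  refine ⟨hx, fun hint => ?_⟩
  obtain ⟨t, ht, htB⟩ := exists_gt_one_lineMap_mem_of_mem_intrinsicInterior hy hint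
  have hneg := hf _ htB
  rw [AffineMap.lineMap_apply_module, map_add, map_smul, map_smul, hfx, smul_zero, add_zero,
    smul_eq_mul] at hneg
  nlinarith

theorem lineMap_mem_intrinsicInterior (hB : Convex ℝ B) {x y : V} {t : ℝ} (hx : x ∈ B)
    (hy : y ∈ intrinsicInterior ℝ B) (ht0 : 0 < t) (ht1 : t ≤ 1) :
    AffineMap.lineMap x y t ∈ intrinsicInterior ℝ B := by
  obtain ⟨hyA, hyB⟩ := mem_intrinsicInterior_iff_mem_nhdsWithin.1 hy
  have hxA := subset_affineSpan ℝ B hx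
  have hcontract (w : V) : AffineMap.lineMap x (AffineMap.lineMap x w t⁻¹) t = w := by
    simp [AffineMap.lineMap_apply, ht0.ne']
  have hexpand : Tendsto (fun w => AffineMap.lineMap x w t⁻¹)
      (𝓝[affineSpan ℝ B] (AffineMap.lineMap x y t)) (𝓝[affineSpan ℝ B] y) := by
    refine tendsto_nhdsWithin_iff.2 ⟨tendsto_nhdsWithin_of_tendsto_nhds ?_,
      eventually_mem_nhdsWithin.mono fun w hw => AffineMap.lineMap_mem _ hxA hw⟩
    have hcont : Continuous fun w : V => AffineMap.lineMap x w t⁻¹ := by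
      simp only [AffineMap.lineMap_apply_module]
      fun_prop
    simpa [AffineMap.lineMap_apply, ht0.ne'] using hcont.tendsto (AffineMap.lineMap x y t)
  refine mem_intrinsicInterior_iff_mem_nhdsWithin.2 ⟨AffineMap.lineMap_mem t hxA hyA, ?_⟩
  filter_upwards [hexpand hyB] with w hw
  exact hcontract w ▸ hB.lineMap_mem hx hw ⟨ht0.le, ht1⟩

theorem exists_one_le_lineMap_mem_relBoundary [T2Space V] (hB : IsCompact B) {x y : V}
    (hx : x ∈ B) (hy : y ∈ B) (hxy : x ≠ y) :
    ∃ t ≥ (1 : ℝ), AffineMap.lineMap x y t ∈ relBoundary B := by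
  have hemb : IsClosedEmbedding (AffineMap.lineMap x y : ℝ → V) := by
    convert (Homeomorph.addRight x).isClosedEmbedding.comp
      (isClosedEmbedding_smul_left (𝕜 := ℝ) (sub_ne_zero.2 hxy.symm)) using 1
    ext t
    simp [AffineMap.lineMap_apply]
  have h1 : (1 : ℝ) ∈ AffineMap.lineMap x y ⁻¹' B := by simpa using hy
  obtain ⟨t, htB, htmax⟩ := (hemb.isCompact_preimage hB).exists_isGreatest ⟨1, h1⟩
  refine ⟨t, htmax h1, htB, fun hint => ?_⟩
  obtain ⟨s, hs, hsB⟩ := exists_gt_one_lineMap_mem_of_mem_intrinsicInterior hx hint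
  rw [AffineMap.lineMap_lineMap_right] at hsB
  nlinarith [htmax hsB, htmax h1]

theorem exists_mem_boundaryWeights_gt [T2Space V] (hBc : Convex ℝ B) (hB : IsCompact B) {x y : V}
    {b : ℝ} (hx : x ∈ relBoundary B) (hy : y ∈ B) (h : ¬OccursWithWeight B b x y) :
    ∃ w ∈ boundaryWeights B y, 1 - b < w := by
  have hxy : x ≠ y := by
    rintro rfl
    exact h ⟨x, hy, by module⟩
  obtain ⟨t, ht, hz⟩ := exists_one_le_lineMap_mem_relBoundary hB hx.1 hy hxy
  have ht0 : 0 < t := by linarith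
  have hs0 : 0 ≤ 1 - t⁻¹ := sub_nonneg.2 (inv_le_one_of_one_le₀ ht)
  have hs1 : 1 - t⁻¹ < 1 := sub_lt_self _ (inv_pos.2 ht0)
  have hy' : (1 - t⁻¹) • x + (1 - (1 - t⁻¹)) • AffineMap.lineMap x y t = y := by
    simp only [AffineMap.lineMap_apply_module]
    match_scalars <;> field_simp <;> ring
  have hsb : 1 - t⁻¹ < b := by
    by_contra! hbs
    exact h (OccursWithWeight.mono hBc hx.1 hbs hs1 ⟨_, hz.1, hy'⟩)
  refine ⟨_, hy' ▸ max_mem_boundaryWeights hs0 hs1.le hx hz, lt_max_of_lt_right ?_⟩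
  linarith

theorem boundariness_lt_of_not_occursWithWeight [T2Space V] (hBc : Convex ℝ B) (hB : IsCompact B)
    {x y : V} {b : ℝ} (hx : x ∈ relBoundary B) (hy : y ∈ B) (h : ¬OccursWithWeight B b x y) :
    boundariness B y < b := by
  obtain ⟨w, hw, hbw⟩ := exists_mem_boundaryWeights_gt hBc hB hx hy h
  have := le_csSup ⟨1, fun _ => le_one_of_mem_boundaryWeights⟩ hw
  rw [boundariness]
  linarith

theorem OccursWithWeight.le_one_sub_of_mem_relBoundary (hB : Convex ℝ B) {x e : V} {b s : ℝ}
    (he : e ∈ intrinsicInterior ℝ B) (hb0 : 0 < b) (hb1 : b ≤ 1)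
    (hocc : ∀ z ∈ B, OccursWithWeight B b z e) (hx : x ∈ relBoundary B) (hs : s ≤ 1)
    (h : OccursWithWeight B s x e) : s ≤ 1 - b := by
  by_contra! hlt
  obtain ⟨z, hz, hxz⟩ := h
  obtain ⟨z', hz', hzz'⟩ := hocc z hz
  have hs0 : 0 < s := by linarith
  have hx' : AffineMap.lineMap z' e (1 - (1 - s) * (1 - b) / (b * s)) = x := by
    simp only [AffineMap.lineMap_apply_module]
    have hz_eq : z = b⁻¹ • (e - (1 - b) • z') := by
      rw [← hzz', add_sub_cancel_right, inv_smul_smul₀ hb0.ne']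
    have hx_eq : x = s⁻¹ • (e - (1 - s) • z) := by
      rw [← hxz, add_sub_cancel_right, inv_smul_smul₀ hs0.ne']
    rw [hx_eq, hz_eq]
    match_scalars <;> field_simp <;> ring
  refine hx.2 (hx' ▸ lineMap_mem_intrinsicInterior hB hz' he ?_ ?_)
  · rw [sub_pos, div_lt_one (by positivity)]
    linarith
  · have : 0 ≤ (1 - s) * (1 - b) / (b * s) :=
      div_nonneg (mul_nonneg (by linarith) (by linarith)) (by positivity)
    linarith

theorem boundariness_eq_of_relBoundary_decomposition (hB : Convex ℝ B) {e x z : V} {b : ℝ}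
    (he : e ∈ intrinsicInterior ℝ B) (hb0 : 0 < b) (hb1 : b ≤ 1)
    (hocc : ∀ z ∈ B, OccursWithWeight B b z e) (hx : x ∈ relBoundary B) (hz : z ∈ relBoundary B)
    (hxz : b • x + (1 - b) • z = e) : boundariness B e = b := by
  have hle : ∀ w ∈ boundaryWeights B e, w ≤ 1 - b := fun w hw => by
    obtain ⟨x, hx, h⟩ := exists_occursWithWeight_of_mem_boundaryWeights hB hw
    exact h.le_one_sub_of_mem_relBoundary hB he hb0 hb1 hocc hx (le_one_of_mem_boundaryWeights hw)
  have hmem := hxz ▸ max_mem_boundaryWeights hb0.le hb1 hx hz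
  have hmax : max b (1 - b) = 1 - b := (hle _ hmem).antisymm (le_max_right _ _)
  rw [boundariness, IsGreatest.csSup_eq ⟨hmax ▸ hmem, hle⟩, sub_sub_cancel]

theorem isGreatest_and_setOf_eq_singleton_of_forall_ne_lt {X α : Type*} [Preorder α] {f : X → α}
    {S : Set X} {e : X} {b : α} (he : e ∈ S) (hfe : f e = b) (hlt : ∀ y ∈ S, y ≠ e → f y < b) :
    IsGreatest (f '' S) b ∧ {y ∈ S | f y = b} = {e} := by
  refine ⟨⟨⟨e, he, hfe⟩, ?_⟩, Set.eq_singleton_iff_unique_mem.2 ⟨⟨he, hfe⟩, ?_⟩⟩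
  · rintro _ ⟨y, hy, rfl⟩
    by_cases hye : y = e
    · exact (hye ▸ hfe).le
    · exact (hlt y hy hye).le
  · rintro y ⟨hy, hfy⟩
    by_contra hye
    exact (hlt y hy hye).ne hfy

end ConvexParts

section PositiveMatrices

open Matrix Topology
open scoped MatrixOrder

variable {m : Type*}

theorem convex_setOf_nonneg : Convex ℝ {M : Matrix m m ℂ | 0 ≤ M} :=
  fun _ hM _ hN _ _ ha hb _ => ((hM.posSemidef.smul ha).add (hN.posSemidef.smul hb)).nonneg

open scoped Matrix.Norms.L2Operator in
theorem isCompact_Icc_zero_smul_one [Finite m] [DecidableEq m] (c : ℝ) :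
    IsCompact (Set.Icc 0 (c • (1 : Matrix m m ℂ))) := by
  have := Fintype.ofFinite m
  have : ProperSpace (Matrix m m ℂ) := FiniteDimensional.proper ℝ _
  refine Metric.isCompact_of_isClosed_isBounded isClosed_Icc ?_
  refine isBounded_iff_forall_norm_le.2 ⟨|c|, fun M hM => ?_⟩
  rw [CStarAlgebra.norm_le_iff_le_algebraMap M (abs_nonneg c) hM.1,
    Algebra.algebraMap_eq_smul_one]
  exact hM.2.trans (smul_le_smul_of_nonneg_right (le_abs_self c) zero_le_one)

open scoped Matrix.Norms.L2Operator in
theorem eventually_neg_smul_one_le_of_isHermitian [Finite m] [DecidableEq m] {r : ℝ}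
    (hr : 0 < r) : ∀ᶠ D in 𝓝 (0 : Matrix m m ℂ), D.IsHermitian → -(r • 1) ≤ D := by
  have := Fintype.ofFinite m
  filter_upwards [Metric.ball_mem_nhds 0 hr] with D hDr hD
  have hnorm : -(‖D‖ • (1 : Matrix m m ℂ)) ≤ D := by
    simpa only [Algebra.algebraMap_eq_smul_one] using
      IsSelfAdjoint.neg_algebraMap_norm_le_self (a := D) hD
  refine le_trans (neg_le_neg ?_) hnorm
  exact smul_le_smul_of_nonneg_right (mem_ball_zero_iff.1 hDr).le zero_le_one

variable [Fintype m]

theorem exists_eq_conjTranspose_mul_self_of_nonneg {X : Matrix m m ℂ} (hX : 0 ≤ X) :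
    ∃ G : Matrix m m ℂ, X = Gᴴ * G := by
  classical
  exact CStarAlgebra.nonneg_iff_eq_star_mul_self.1 hX

theorem exists_trace_mul_eq_trace_mul_conjTranspose_self {X P : Matrix m m ℂ} (hX : 0 ≤ X)
    (hP : 0 ≤ P) :
    ∃ K : Matrix m m ℂ, (X * P).trace = (K * Kᴴ).trace ∧ (K = 0 → X * P = 0) := by
  obtain ⟨G, rfl⟩ := exists_eq_conjTranspose_mul_self_of_nonneg hX
  obtain ⟨H, rfl⟩ := exists_eq_conjTranspose_mul_self_of_nonneg hP
  refine ⟨G * Hᴴ, ?_, fun hK => ?_⟩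
  · rw [Matrix.mul_assoc, trace_mul_comm]
    simp only [conjTranspose_mul, conjTranspose_conjTranspose, Matrix.mul_assoc]
  · rw [Matrix.mul_assoc, ← Matrix.mul_assoc G, hK, Matrix.zero_mul, Matrix.mul_zero]

theorem trace_mul_nonneg {X P : Matrix m m ℂ} (hX : 0 ≤ X) (hP : 0 ≤ P) :
    0 ≤ (X * P).trace := by
  obtain ⟨K, hK, -⟩ := exists_trace_mul_eq_trace_mul_conjTranspose_self hX hP
  exact hK ▸ (posSemidef_self_mul_conjTranspose K).trace_nonneg

theorem mul_eq_zero_of_trace_mul_eq_zero {X P : Matrix m m ℂ} (hX : 0 ≤ X) (hP : 0 ≤ P)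
    (h : (X * P).trace = 0) : X * P = 0 := by
  obtain ⟨K, hK, hXP⟩ := exists_trace_mul_eq_trace_mul_conjTranspose_self hX hP
  exact hXP (trace_mul_conjTranspose_self_eq_zero_iff.1 (hK ▸ h))

variable [DecidableEq m]

theorem le_re_trace_smul_one {M : Matrix m m ℂ} (hM : 0 ≤ M) :
    M ≤ M.trace.re • (1 : Matrix m m ℂ) := by
  have hM' := hM.posSemidef
  rw [← Algebra.algebraMap_eq_smul_one, le_algebraMap_iff_spectrum_le,
    hM'.isHermitian.spectrum_real_eq_range_eigenvalues]
  rintro _ ⟨i, rfl⟩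
  have htrace : M.trace.re = ∑ j, hM'.isHermitian.eigenvalues j := by
    simp [hM'.isHermitian.trace_eq_sum_eigenvalues]
  exact htrace ▸ Finset.single_le_sum (fun j _ => hM'.eigenvalues_nonneg j) (Finset.mem_univ i)

/-- A resolution of the identity by projections, scaled by `c`: for `c > 0` the matrices
`c⁻¹ • P a` are orthogonal projections with sum `1`. The scaling spares the Choi matrices of
channels, which have trace `d`, a normalization. -/
structure IsScaledResolution {ι : Type*} [Fintype ι] (c : ℝ) (P : ι → Matrix m m ℂ) : Prop where
  nonneg (a : ι) : 0 ≤ P a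
  mul_self (a : ι) : P a * P a = c • P a
  sum_eq : ∑ a, P a = c • 1

theorem IsScaledResolution.eq_smul_one_of_forall_smul_le {ι : Type*} [Fintype ι] {c b : ℝ}
    {P : ι → Matrix m m ℂ} {M : Matrix m m ℂ} (hP : IsScaledResolution c P) (hc : c ≠ 0)
    (hM : ∀ a, b • P a ≤ M) (htr : M.trace = ((b * c) • (1 : Matrix m m ℂ)).trace) :
    M = (b * c) • 1 := by
  have hX (a : ι) : 0 ≤ M - b • P a := sub_nonneg.2 (hM a)
  have hXP (a : ι) : (M - b • P a) * P a = M * P a - (b * c) • P a := by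
    rw [Matrix.sub_mul, smul_mul, hP.mul_self, smul_smul]
  have hsum : ∑ a, (M - b • P a) * P a = c • (M - (b * c) • 1) := by
    simp only [hXP, Finset.sum_sub_distrib, ← Finset.mul_sum, ← Finset.smul_sum, hP.sum_eq,
      mul_smul_one, smul_sub, smul_comm c (b * c)]
  have htrace_sum : ∑ a, ((M - b • P a) * P a).trace = 0 := by
    rw [← trace_sum, hsum, trace_smul, trace_sub, htr, sub_self, smul_zero]
  have hzero (a : ι) : (M - b • P a) * P a = 0 :=
    mul_eq_zero_of_trace_mul_eq_zero (hX a) (hP.nonneg a) <|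
      (Finset.sum_eq_zero_iff_of_nonneg fun a _ => trace_mul_nonneg (hX a) (hP.nonneg a)).1
        htrace_sum a (Finset.mem_univ a)
  rw [Finset.sum_eq_zero fun a _ => hzero a, eq_comm, smul_eq_zero_iff_right hc] at hsum
  exact sub_eq_zero.1 hsum

end PositiveMatrices

section Spectrahedra

open Filter Matrix Topology
open scoped MatrixOrder

variable {V m : Type*} [AddCommGroup V] [Module ℝ V] {A : AffineSubspace ℝ V}
  {C : V →ₗ[ℝ] Matrix m m ℂ}

/-- The spectrahedron cut out of the affine subspace `A` by the linear matrix inequality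
`0 ≤ C x`. States, observables and channels are all of this form: `C` is the identity, the
block-diagonal embedding and the Choi matrix, respectively. -/
def spectrahedron (A : AffineSubspace ℝ V) (C : V →ₗ[ℝ] Matrix m m ℂ) : Set V :=
  {x | x ∈ A ∧ 0 ≤ C x}

theorem convex_spectrahedron : Convex ℝ (spectrahedron A C) :=
  A.convex.inter (convex_setOf_nonneg.linear_preimage C)

theorem isCompact_spectrahedron [Finite m] [DecidableEq m] [TopologicalSpace V]
    [IsTopologicalAddGroup V] [ContinuousSMul ℝ V] [T2Space V] (hC : Function.Injective C) {c : ℝ}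
    (hc : ∀ x ∈ spectrahedron A C, C x ≤ c • 1) : IsCompact (spectrahedron A C) := by
  have := Fintype.ofFinite m
  have : FiniteDimensional ℝ V := .of_injective C hC
  have hemb : IsClosedEmbedding C :=
    LinearMap.isClosedEmbedding_of_injective (LinearMap.ker_eq_bot.2 hC)
  have hset : spectrahedron A C = C ⁻¹' Set.Icc 0 (c • 1) ∩ A := by
    ext x
    exact ⟨fun hx => ⟨⟨hx.2, hc x hx⟩, hx.1⟩, fun hx => ⟨hx.2, hx.1.1⟩⟩
  rw [hset]
  exact (hemb.isCompact_preimage (isCompact_Icc_zero_smul_one c)).inter_right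
    (A.isClosed_direction_iff.1 A.direction.closed_of_finiteDimensional)

theorem isHermitian_of_mem_affineSpan_spectrahedron {x : V}
    (hx : x ∈ affineSpan ℝ (spectrahedron A C)) : (C x).IsHermitian := by
  let S := (selfAdjoint.submodule ℝ (Matrix m m ℂ)).comap C
  have hle : affineSpan ℝ (spectrahedron A C) ≤ S.toAffineSubspace :=
    affineSpan_le.2 fun x hx => hx.2.posSemidef.isHermitian
  exact hle hx

theorem mem_intrinsicInterior_spectrahedron [Finite m] [DecidableEq m] [TopologicalSpace V]
    (hC : Continuous C) {x : V} {r : ℝ} (hx : x ∈ spectrahedron A C) (hr : 0 < r)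
    (hrx : r • 1 ≤ C x) : x ∈ intrinsicInterior ℝ (spectrahedron A C) := by
  have hxA := subset_affineSpan ℝ _ hx
  refine mem_intrinsicInterior_iff_mem_nhdsWithin.2 ⟨hxA, ?_⟩
  have hdiff : Tendsto (fun w => C w - C x) (𝓝 x) (𝓝 0) :=
    tendsto_sub_nhds_zero_iff.2 hC.continuousAt
  filter_upwards [self_mem_nhdsWithin, nhdsWithin_le_nhds
    (hdiff.eventually (eventually_neg_smul_one_le_of_isHermitian hr))] with w hwA hw
  have hle : affineSpan ℝ (spectrahedron A C) ≤ A := affineSpan_le.2 fun _ h => h.1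
  refine ⟨hle hwA, ?_⟩
  have hdiff_le : -(r • 1) ≤ C w - C x :=
    hw ((isHermitian_of_mem_affineSpan_spectrahedron hwA).sub
      (isHermitian_of_mem_affineSpan_spectrahedron hxA))
  simpa using add_le_add hrx hdiff_le

theorem mem_relBoundary_spectrahedron [Fintype m] [TopologicalSpace V] [IsTopologicalAddGroup V]
    [ContinuousSMul ℝ V] {x y : V} {Q : Matrix m m ℂ} (hx : x ∈ spectrahedron A C)
    (hy : y ∈ spectrahedron A C) (hQ : 0 ≤ Q) (hxQ : C x * Q = 0)
    (hyQ : 0 < (C y * Q).trace.re) : x ∈ relBoundary (spectrahedron A C) := by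
  let f : V →ₗ[ℝ] ℝ := Complex.reLm ∘ₗ traceLinearMap m ℝ ℂ ∘ₗ LinearMap.mulRight ℝ Q ∘ₗ C
  refine mem_relBoundary_of_linearMap_eq_zero f (fun z hz => ?_) hx hy ?_ hyQ
  · exact (Complex.nonneg_iff.1 (trace_mul_nonneg hz.2 hQ)).1
  · simp [f, hxQ]

theorem occursWithWeight_spectrahedron [DecidableEq m] {x e : V} {b c : ℝ} (hb0 : 0 ≤ b)
    (hb1 : b < 1) (hxA : x ∈ A) (heA : e ∈ A) (hx : C x ≤ c • 1) (he : C e = (b * c) • 1) :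
    OccursWithWeight (spectrahedron A C) b x e := by
  have hb : 0 < 1 - b := sub_pos.2 hb1
  refine ⟨AffineMap.lineMap x e (1 - b)⁻¹, ⟨AffineMap.lineMap_mem _ hxA heA, ?_⟩, ?_⟩
  · have hz : C (AffineMap.lineMap x e (1 - b)⁻¹) = (b / (1 - b)) • (c • 1 - C x) := by
      simp only [AffineMap.lineMap_apply_module, map_add, map_smul, he]
      match_scalars <;> field_simp
      ring
    rw [hz]
    exact ((sub_nonneg.2 hx).posSemidef.smul (div_nonneg hb0 hb.le)).nonneg
  · simp only [AffineMap.lineMap_apply_module]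
    match_scalars <;> field_simp
    ring

theorem spectrahedron_eq_singleton [Fintype m] {e : V} (hC : Function.Injective C)
    (he : e ∈ spectrahedron A C) (hle : ∀ x ∈ spectrahedron A C, C x ≤ C e)
    (htr : ∀ x ∈ spectrahedron A C, (C x).trace = (C e).trace) : spectrahedron A C = {e} := by
  refine Set.eq_singleton_iff_unique_mem.2 ⟨he, fun x hx => hC ?_⟩
  have h : C e - C x = 0 := (sub_nonneg.2 (hle x hx)).posSemidef.trace_eq_zero_iff.1 <| by
    rw [trace_sub, htr x hx, sub_self]
  exact (sub_eq_zero.1 h).symm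

section Center

variable [Fintype m] [DecidableEq m] [Nonempty m] [TopologicalSpace V] [IsTopologicalAddGroup V]
  [ContinuousSMul ℝ V] {e p : V} {b c : ℝ}

theorem re_trace_smul_one_pos {r : ℝ} (hr : 0 < r) : 0 < (r • (1 : Matrix m m ℂ)).trace.re := by
  simp [trace_smul, hr, Fintype.card_pos]

theorem mem_relBoundary_spectrahedron_of_mul_self (hb0 : 0 < b) (hb1 : b < 1) (hc : 0 < c)
    (he : e ∈ spectrahedron A C) (hp : p ∈ spectrahedron A C) (hpc : C p ≤ c • 1)
    (hpp : C p * C p = c • C p) (hCe : C e = (b * c) • 1) (htr : (C p).trace = (C e).trace) :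
    p ∈ relBoundary (spectrahedron A C) := by
  refine mem_relBoundary_spectrahedron hp he (sub_nonneg.2 hpc) ?_ ?_
  · rw [Matrix.mul_sub, hpp, mul_smul_one, sub_self]
  · have hQ : (C e * (c • 1 - C p)).trace =
        ((b * c * ((1 - b) * c)) • (1 : Matrix m m ℂ)).trace := by
      rw [hCe, smul_mul, Matrix.one_mul, trace_smul, trace_sub, htr, hCe, ← trace_sub, ← trace_smul]
      congr 1
      module
    rw [hQ]
    exact re_trace_smul_one_pos (by have := sub_pos.2 hb1; positivity)

theorem mem_relBoundary_spectrahedron_of_complement {z : V} (hb0 : 0 < b) (hb1 : b < 1)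
    (hc : 0 < c) (he : e ∈ spectrahedron A C) (hz : z ∈ spectrahedron A C) (hp : 0 ≤ C p)
    (hpp : C p * C p = c • C p) (hCe : C e = (b * c) • 1) (htr : (C p).trace = (C e).trace)
    (hze : b • p + (1 - b) • z = e) : z ∈ relBoundary (spectrahedron A C) := by
  have hzp : (1 - b) • (C z * C p) = 0 := by
    have h : C (b • p + (1 - b) • z) * C p = C e * C p := by rw [hze]
    rw [map_add, map_smul, map_smul, Matrix.add_mul, smul_mul, smul_mul, hpp, hCe, smul_mul,
      Matrix.one_mul, smul_smul] at h
    simpa using h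
  refine mem_relBoundary_spectrahedron hz he hp ?_ ?_
  · exact (smul_eq_zero_iff_right (sub_pos.2 hb1).ne').1 hzp
  · rw [hCe, smul_mul, Matrix.one_mul, trace_smul, htr, hCe, ← trace_smul, smul_smul]
    exact re_trace_smul_one_pos (by positivity)

theorem boundariness_spectrahedron_center (hC : Continuous C) (hb0 : 0 < b) (hb1 : b < 1)
    (hc : 0 < c) (hle : ∀ x ∈ spectrahedron A C, C x ≤ c • 1) (he : e ∈ spectrahedron A C)
    (hCe : C e = (b * c) • 1) (hp : p ∈ spectrahedron A C) (hpp : C p * C p = c • C p)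
    (htr : (C p).trace = (C e).trace) : boundariness (spectrahedron A C) e = b := by
  have hocc : ∀ x ∈ spectrahedron A C, OccursWithWeight (spectrahedron A C) b x e := fun x hx =>
    occursWithWeight_spectrahedron hb0.le hb1 hx.1 he.1 (hle x hx) hCe
  obtain ⟨z, hz, hze⟩ := hocc p hp
  exact boundariness_eq_of_relBoundary_decomposition convex_spectrahedron
    (mem_intrinsicInterior_spectrahedron hC he (mul_pos hb0 hc) hCe.ge) hb0 hb1.le hocc
    (mem_relBoundary_spectrahedron_of_mul_self hb0 hb1 hc he hp (hle p hp) hpp hCe htr)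
    (mem_relBoundary_spectrahedron_of_complement hb0 hb1 hc he hz hp.2 hpp hCe htr hze) hze

end Center

section Frame

variable [Fintype m] [DecidableEq m] {ι : Type*} [Fintype ι] {e : V} {p : ι → V} {c : ℝ}

theorem boundariness_spectrahedron_lt [TopologicalSpace V] [IsTopologicalAddGroup V]
    [ContinuousSMul ℝ V] [T2Space V] {b : ℝ} (hC : Function.Injective C) (hc : c ≠ 0) (hb : b ≤ 1)
    (hle : ∀ x ∈ spectrahedron A C, C x ≤ c • 1) (hP : IsScaledResolution c fun a => C (p a))
    (hp : ∀ a, p a ∈ relBoundary (spectrahedron A C)) (hCe : C e = (b * c) • 1) {y : V}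
    (hy : y ∈ spectrahedron A C) (htr : (C y).trace = (C e).trace) (hye : y ≠ e) :
    boundariness (spectrahedron A C) y < b := by
  obtain ⟨a, ha⟩ : ∃ a, ¬OccursWithWeight (spectrahedron A C) b (p a) y := by
    by_contra! hocc
    have hsmul_le (a : ι) : b • C (p a) ≤ C y := by
      obtain ⟨z, hz, rfl⟩ := hocc a
      rw [map_add, map_smul, map_smul]
      exact le_add_of_nonneg_right (smul_nonneg (sub_nonneg.2 hb) hz.2)
    refine hye (hC ?_)
    rw [hCe, hP.eq_smul_one_of_forall_smul_le hc hsmul_le (hCe ▸ htr)]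
  exact boundariness_lt_of_not_occursWithWeight convex_spectrahedron
    (isCompact_spectrahedron hC hle) (hp a) hy ha

theorem mem_spectrahedron_of_isScaledResolution [Nonempty ι] (hC : Function.Injective C)
    (hP : IsScaledResolution c fun a => C (p a)) (hp : ∀ a, p a ∈ spectrahedron A C)
    (hCe : C e = ((Fintype.card ι : ℝ)⁻¹ * c) • 1) : e ∈ spectrahedron A C := by
  have he : ∑ a, (Fintype.card ι : ℝ)⁻¹ • p a = e := hC <| by
    rw [← Finset.smul_sum, map_smul, map_sum, hP.sum_eq, hCe, smul_smul]
  rw [← he]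
  exact convex_spectrahedron.sum_mem (fun _ _ => by positivity) (by simp) fun a _ => hp a

theorem boundariness_spectrahedron_max [Nonempty m] [Nonempty ι] [TopologicalSpace V]
    [IsTopologicalAddGroup V] [ContinuousSMul ℝ V] [T2Space V] {b : ℝ}
    (hC : Function.Injective C) (hb : (Fintype.card ι : ℝ)⁻¹ = b) (hc : 0 < c)
    (hle : ∀ x ∈ spectrahedron A C, C x ≤ c • 1)
    (htr : ∀ x ∈ spectrahedron A C, (C x).trace = (C e).trace)
    (hP : IsScaledResolution c fun a => C (p a)) (hp : ∀ a, p a ∈ spectrahedron A C)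
    (hCe : C e = (b * c) • 1) :
    IsGreatest (boundariness (spectrahedron A C) '' spectrahedron A C) b ∧
      {x ∈ spectrahedron A C | boundariness (spectrahedron A C) x = b} = {e} := by
  subst hb
  have he := mem_spectrahedron_of_isScaledResolution hC hP hp hCe
  have hb0 : 0 < (Fintype.card ι : ℝ)⁻¹ := inv_pos.2 (by exact_mod_cast Fintype.card_pos)
  obtain hι | hι : Fintype.card ι = 1 ∨ 1 < Fintype.card ι := by
    have := Fintype.card_pos (α := ι)
    omega
  · rw [hι, Nat.cast_one, inv_one, one_mul] at hCe
    rw [hι, Nat.cast_one, inv_one, spectrahedron_eq_singleton hC he (hCe ▸ hle) htr]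
    refine isGreatest_and_setOf_eq_singleton_of_forall_ne_lt rfl (boundariness_singleton e) ?_
    exact fun y hy hye => (hye hy).elim
  · have hb1 : (Fintype.card ι : ℝ)⁻¹ < 1 := inv_lt_one_of_one_lt₀ (by exact_mod_cast hι)
    have : FiniteDimensional ℝ V := .of_injective C hC
    refine isGreatest_and_setOf_eq_singleton_of_forall_ne_lt he ?_ fun y hy hye => ?_
    · obtain a := Classical.arbitrary ι
      exact boundariness_spectrahedron_center C.continuous_of_finiteDimensional hb0 hb1 hc hle
        he hCe (hp a) (hP.mul_self a) (htr _ (hp a))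
    · refine boundariness_spectrahedron_lt hC hc.ne' hb1.le hle hP (fun a => ?_) hCe hy (htr y hy)
        hye
      exact mem_relBoundary_spectrahedron_of_mul_self hb0 hb1 hc he (hp a) (hle _ (hp a))
        (hP.mul_self a) hCe (htr _ (hp a))

end Frame

end Spectrahedra

section LevelSets

variable {V W : Type*} [AddCommGroup V] [Module ℝ V] [AddCommGroup W] [Module ℝ W]

/-- The solution set of the linear equation `f x = w`, as an affine subspace. It encodes the
normalization conditions of states, observables and channels. -/
def affineLevelSet (f : V →ₗ[ℝ] W) (w : W) : AffineSubspace ℝ V :=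
  (affineSpan ℝ {w}).comap f.toAffineMap

theorem mem_affineLevelSet {f : V →ₗ[ℝ] W} {w : W} {x : V} : x ∈ affineLevelSet f w ↔ f x = w := by
  simp [affineLevelSet]

theorem mem_affineLevelSet_sum_proj {ι : Type*} [Fintype ι] {E : ι → W} {w : W} :
    E ∈ affineLevelSet (∑ j, LinearMap.proj j) w ↔ ∑ j, E j = w := by
  simp [mem_affineLevelSet]

end LevelSets

section States

open Matrix
open scoped MatrixOrder

theorem isScaledResolution_single {m : Type*} [Fintype m] [DecidableEq m] :
    IsScaledResolution 1 fun a : m => (single a a 1 : Matrix m m ℂ) where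
  nonneg a := by
    rw [← diagonal_single]
    exact (PosSemidef.diagonal (Pi.single_nonneg.2 zero_le_one)).nonneg
  mul_self a := by simp
  sum_eq := by rw [one_smul, sum_single_one]

theorem quantumStates_eq_spectrahedron (d : ℕ) :
    quantumStates d =
      spectrahedron (affineLevelSet (traceLinearMap (Fin d) ℝ ℂ) 1) LinearMap.id := by
  ext ρ
  exact ⟨fun h => ⟨mem_affineLevelSet.2 h.2, h.1.nonneg⟩,
    fun h => ⟨h.2.posSemidef, mem_affineLevelSet.1 h.1⟩⟩

theorem quantumStates_boundariness_max {d : ℕ} (hd : 1 ≤ d) :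
    IsGreatest (boundariness (quantumStates d) '' quantumStates d) (1 / (d : ℝ)) ∧
      {ρ ∈ quantumStates d | boundariness (quantumStates d) ρ = 1 / (d : ℝ)} =
        {completelyMixedState d} := by
  have : NeZero d := ⟨Nat.one_le_iff_ne_zero.1 hd⟩
  have hmixed : completelyMixedState d = (1 / (d : ℝ) * 1) • 1 := by
    rw [completelyMixedState, inv_natCast_smul_eq ℂ ℝ, mul_one, one_div]
  rw [quantumStates_eq_spectrahedron]
  refine boundariness_spectrahedron_max (c := 1) Function.injective_id (by simp) one_pos
    (fun ρ hρ => ?_) (fun ρ hρ => ?_) isScaledResolution_single (fun a => ⟨?_, ?_⟩) hmixed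
  · have htr : ρ.trace = 1 := mem_affineLevelSet.1 hρ.1
    simpa [htr] using le_re_trace_smul_one hρ.2
  · refine (mem_affineLevelSet.1 hρ.1).trans ?_
    simp [completelyMixedState, trace_smul]
  · exact mem_affineLevelSet.2 (trace_single_eq_same a 1)
  · exact isScaledResolution_single.nonneg a

end States

section Observables

open Matrix
open scoped MatrixOrder

variable {m ι : Type*}

theorem le_one_of_sum_eq_one [DecidableEq m] [Fintype ι] {E : ι → Matrix m m ℂ} (hE : 0 ≤ E)
    (hsum : ∑ j, E j = 1) : E ≤ 1 := fun j => by
  rw [Pi.one_apply, ← hsum]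
  exact Finset.single_le_sum (fun k _ => hE k) (Finset.mem_univ j)

variable [DecidableEq ι]

/-- The block-diagonal embedding of tuples of matrices, as a real-linear map. -/
def blockDiagonalLinearMap (m ι : Type*) [DecidableEq ι] :
    (ι → Matrix m m ℂ) →ₗ[ℝ] Matrix (m × ι) (m × ι) ℂ where
  toFun := blockDiagonal
  map_add' := blockDiagonal_add
  map_smul' := blockDiagonal_smul

theorem blockDiagonalLinearMap_apply (E : ι → Matrix m m ℂ) :
    blockDiagonalLinearMap m ι E = blockDiagonal E :=
  rfl

theorem blockDiagonal_nonneg_iff [Finite m] [Finite ι] {E : ι → Matrix m m ℂ} :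
    0 ≤ blockDiagonal E ↔ 0 ≤ E := by
  have := Fintype.ofFinite m
  have := Fintype.ofFinite ι
  refine ⟨fun h j => ?_, fun h => ?_⟩
  · have hsub : (blockDiagonal E).submatrix (·, j) (·, j) = E j := by
      ext a b
      simp
    exact hsub ▸ (h.posSemidef.submatrix (·, j)).nonneg
  · choose G hG using fun j => exists_eq_conjTranspose_mul_self_of_nonneg (h j)
    have hE : blockDiagonal E = (blockDiagonal G)ᴴ * blockDiagonal G := by
      rw [blockDiagonal_conjTranspose, ← blockDiagonal_mul, ← funext hG]
    exact hE ▸ (posSemidef_conjTranspose_mul_self _).nonneg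

theorem isScaledResolution_blockDiagonal_single [Fintype m] [Fintype ι] [DecidableEq m] :
    IsScaledResolution 1 fun j => blockDiagonalLinearMap m ι (Pi.single j 1) where
  nonneg j := blockDiagonal_nonneg_iff.2 (Pi.single_nonneg.2 zero_le_one)
  mul_self j := by
    rw [blockDiagonalLinearMap_apply, ← blockDiagonal_mul, one_smul]
    have hsq : (Pi.single j 1 * Pi.single j 1 : ι → Matrix m m ℂ) = Pi.single j 1 := by
      rw [← Pi.single_mul, mul_one]
    exact congrArg blockDiagonal hsq
  sum_eq := by
    rw [← map_sum, one_smul]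
    exact (congrArg _ (Finset.univ_sum_single 1)).trans blockDiagonal_one

theorem quantumObservables_eq_spectrahedron (d n : ℕ) :
    quantumObservables d n =
      spectrahedron (affineLevelSet (∑ j, LinearMap.proj j) 1)
        (blockDiagonalLinearMap (Fin d) (Fin n)) := by
  ext E
  refine ⟨fun h => ⟨mem_affineLevelSet_sum_proj.2 h.2,
    blockDiagonal_nonneg_iff.2 fun j => (h.1 j).1.nonneg⟩, fun ⟨hsum, h⟩ => ?_⟩
  have hE := blockDiagonal_nonneg_iff.1 h
  have hE1 := le_one_of_sum_eq_one hE (mem_affineLevelSet_sum_proj.1 hsum)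
  exact ⟨fun j => ⟨(hE j).posSemidef, (sub_nonneg.2 (hE1 j)).posSemidef⟩,
    mem_affineLevelSet_sum_proj.1 hsum⟩

theorem quantumObservables_boundariness_max {d n : ℕ} (hd : 1 ≤ d) (hn : 1 ≤ n) :
    IsGreatest (boundariness (quantumObservables d n) '' quantumObservables d n) (1 / (n : ℝ)) ∧
      {E ∈ quantumObservables d n | boundariness (quantumObservables d n) E = 1 / (n : ℝ)} =
        {uniformTrivialObservable d n} := by
  have : NeZero d := ⟨Nat.one_le_iff_ne_zero.1 hd⟩
  have : NeZero n := ⟨Nat.one_le_iff_ne_zero.1 hn⟩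
  have hunif : uniformTrivialObservable d n = (1 / (n : ℝ) * 1) • 1 := by
    ext1 j
    rw [uniformTrivialObservable, inv_natCast_smul_eq ℂ ℝ, mul_one, one_div]
    rfl
  rw [quantumObservables_eq_spectrahedron]
  have htr {E : Fin n → Op d} (hE : ∑ j, E j = 1) : (blockDiagonal E).trace = d := by
    rw [trace_blockDiagonal, ← trace_sum, hE, trace_one, Fintype.card_fin]
  refine boundariness_spectrahedron_max (c := 1) blockDiagonal_injective (by simp)
    one_pos (fun E hE => ?_) (fun E hE => ?_) isScaledResolution_blockDiagonal_single
    (fun j => ⟨?_, ?_⟩) ?_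
  · rw [one_smul, ← sub_nonneg, ← blockDiagonal_one, blockDiagonalLinearMap_apply,
      ← blockDiagonal_sub]
    exact blockDiagonal_nonneg_iff.2 (sub_nonneg.2
      (le_one_of_sum_eq_one (blockDiagonal_nonneg_iff.1 hE.2) (mem_affineLevelSet_sum_proj.1 hE.1)))
  · refine (htr (mem_affineLevelSet_sum_proj.1 hE.1)).trans (htr ?_).symm
    simp [uniformTrivialObservable, ← Nat.cast_smul_eq_nsmul ℂ, smul_smul]
  · exact mem_affineLevelSet_sum_proj.2 (Fintype.sum_pi_single' j 1)
  · exact isScaledResolution_blockDiagonal_single.nonneg j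
  · rw [hunif, map_smul, blockDiagonalLinearMap_apply, blockDiagonal_one]

end Observables

section WeylMatrices

open Matrix

variable {R : Type*} [CommRing R] {ψ : AddChar R ℂ}

theorem addChar_mul_star [Finite R] (x y : R) : ψ x * star (ψ y) = ψ (x - y) := by
  rw [sub_eq_add_neg, AddChar.map_add_eq_mul, AddChar.map_neg_eq_conj]
  rfl

variable [DecidableEq R]

/-- The discrete Weyl (shift-and-clock) matrix with shift `a.1` and modulation `a.2`. With `ψ` a
primitive character of `ZMod d`, these `d²` unitaries form an orthogonal basis of all `d × d`
matrices. -/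
def weylMatrix (ψ : AddChar R ℂ) (a : R × R) : Matrix R R ℂ :=
  of fun k i => if k = i + a.1 then ψ (a.2 * i) else 0

theorem weylMatrix_apply (a : R × R) (k i : R) :
    weylMatrix ψ a k i = if k = i + a.1 then ψ (a.2 * i) else 0 :=
  rfl

variable [Fintype R]

theorem conjTranspose_weylMatrix_mul_self (a : R × R) :
    (weylMatrix ψ a)ᴴ * weylMatrix ψ a = 1 := by
  ext i j
  simp only [mul_apply, conjTranspose_apply, weylMatrix_apply]
  rw [Finset.sum_eq_single (i + a.1) (fun k _ hk => by simp [hk]) (by simp)]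
  obtain rfl | hij := eq_or_ne i j
  · rw [if_pos rfl, one_apply_eq, mul_comm, addChar_mul_star, sub_self, AddChar.map_zero_eq_one]
  · simp [hij]

theorem sum_weylMatrix_mul_star (hψ : ψ.IsPrimitive) (k i l j : R) :
    ∑ a, weylMatrix ψ a k i * star (weylMatrix ψ a l j) =
      if i = j ∧ k = l then (Fintype.card R : ℂ) else 0 := by
  have hclock (s : R) : ∑ t, weylMatrix ψ (s, t) k i * star (weylMatrix ψ (s, t) l j) =
      if k = i + s ∧ l = j + s ∧ i = j then (Fintype.card R : ℂ) else 0 := by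
    by_cases hk : k = i + s <;> by_cases hl : l = j + s <;> simp only [weylMatrix_apply, hk, hl,
      if_true, if_false, true_and, false_and, zero_mul, star_zero, mul_zero, Finset.sum_const_zero]
    simp only [addChar_mul_star, ← mul_sub, AddChar.sum_mulShift _ hψ, sub_eq_zero, Nat.cast_ite,
      Nat.cast_zero]
  rw [Fintype.sum_prod_type, Finset.sum_congr rfl fun s _ => hclock s,
    Finset.sum_eq_single (k - i) (fun s _ hs => if_neg fun h => hs ?_) (by simp)]
  · refine if_congr ?_ rfl rfl
    grind
  · rw [h.1, add_sub_cancel_left]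

theorem exists_unitary_basis (d : ℕ) [NeZero d] :
    ∃ U : ZMod d × ZMod d → Matrix (Fin d) (Fin d) ℂ, (∀ a, (U a)ᴴ * U a = 1) ∧
      ∀ k i l j, ∑ a, U a k i * star (U a l j) = if i = j ∧ k = l then (d : ℂ) else 0 := by
  have hψ := ZMod.isPrimitive_stdAddChar d
  let σ := (ZMod.finEquiv d).toEquiv
  refine ⟨fun a => (weylMatrix ZMod.stdAddChar a).submatrix σ σ, fun a => ?_, fun k i l j => ?_⟩
  · rw [conjTranspose_submatrix, submatrix_mul_equiv, conjTranspose_weylMatrix_mul_self,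
      submatrix_one_equiv]
  · simpa [σ.injective.eq_iff] using sum_weylMatrix_mul_star hψ (σ k) (σ i) (σ l) (σ j)

end WeylMatrices

section Channels

open Matrix
open scoped Kronecker MatrixOrder

variable {d : ℕ}

/-- The Choi matrix of a map on operators, as a real-linear function of the map. -/
noncomputable def choiMatrix (d : ℕ) :
    (Op d →L[ℂ] Op d) →ₗ[ℝ] Matrix (Fin d × Fin d) (Fin d × Fin d) ℂ where
  toFun Φ := of fun p q => Φ (single p.1 q.1 1) p.2 q.2
  map_add' _ _ := rfl
  map_smul' _ _ := rfl

theorem choiMatrix_apply (Φ : Op d →L[ℂ] Op d) (p q : Fin d × Fin d) :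
    choiMatrix d Φ p q = Φ (single p.1 q.1 1) p.2 q.2 :=
  rfl

theorem apply_eq_sum_choiMatrix (Φ : Op d →L[ℂ] Op d) (X : Op d) (k l : Fin d) :
    Φ X k l = ∑ i, ∑ j, X i j * choiMatrix d Φ (i, k) (j, l) := by
  have hsingle (i j : Fin d) : single i j (X i j) = X i j • single i j (1 : ℂ) := by
    rw [smul_single, smul_eq_mul, mul_one]
  conv_lhs => rw [matrix_eq_sum_single X]
  simp only [hsingle, map_sum, map_smul, Matrix.sum_apply, Matrix.smul_apply, smul_eq_mul,
    choiMatrix_apply]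

theorem choiMatrix_injective : Function.Injective (choiMatrix d) := fun Φ Ψ h => by
  ext X k l
  rw [apply_eq_sum_choiMatrix, apply_eq_sum_choiMatrix, h]

theorem posSemidef_choiMatrix_of_ampliation {Φ : Op d →L[ℂ] Op d}
    (h : ∀ X : Matrix (Fin d × Fin d) (Fin d × Fin d) ℂ,
      X.PosSemidef → (ampliation d Φ X).PosSemidef) : (choiMatrix d Φ).PosSemidef := by
  -- The unnormalized maximally entangled vector.
  let w : Fin d × Fin d → ℂ := fun p => if p.1 = p.2 then 1 else 0
  have hw (p q : Fin d) : (of fun i j => vecMulVec w (star w) (p, i) (q, j)) = single p q 1 := by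
    ext i j
    by_cases hi : p = i <;> by_cases hj : q = j <;> simp [w, vecMulVec_apply, hi, hj]
  have hchoi : choiMatrix d Φ = ampliation d Φ (vecMulVec w (star w)) := by
    ext p q
    rw [choiMatrix_apply, ampliation, of_apply, hw]
  exact hchoi ▸ h _ (posSemidef_vecMulVec_self_star w)

theorem posSemidef_of_sum_sum {m n : Type*} [Finite m] [Fintype n] {S : Matrix (m × n) (m × n) ℂ}
    (hS : S.PosSemidef) : (of fun p q => ∑ i, ∑ j, S (p, i) (q, j)).PosSemidef := by
  classical
  have := Fintype.ofFinite m
  convert hS.conjTranspose_mul_mul_same (of fun r q => if r.1 = q then 1 else 0) using 1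
  ext p q
  simpa [mul_apply, Fintype.sum_prod_type_right] using Finset.sum_comm

theorem posSemidef_ampliation {Φ : Op d →L[ℂ] Op d} (hΦ : (choiMatrix d Φ).PosSemidef) {k : ℕ}
    {X : Matrix (Fin k × Fin d) (Fin k × Fin d) ℂ} (hX : X.PosSemidef) :
    (ampliation k Φ X).PosSemidef := by
  have hS := (hX.kronecker hΦ).submatrix
    fun r : (Fin k × Fin d) × Fin d => ((r.1.1, r.2), (r.2, r.1.2))
  convert posSemidef_of_sum_sum hS using 1
  ext p q
  simp [ampliation, apply_eq_sum_choiMatrix]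

theorem mem_quantumChannels_iff {Φ : Op d →L[ℂ] Op d} :
    Φ ∈ quantumChannels d ↔
      (choiMatrix d Φ).PosSemidef ∧ ∀ X : Op d, (Φ X).trace = X.trace :=
  ⟨fun h => ⟨posSemidef_choiMatrix_of_ampliation (h.1 d), h.2⟩,
    fun h => ⟨fun _ _ hX => posSemidef_ampliation h.1 hX, h.2⟩⟩

theorem trace_choiMatrix {Φ : Op d →L[ℂ] Op d} (h : ∀ X : Op d, (Φ X).trace = X.trace) :
    (choiMatrix d Φ).trace = d := by
  have hsum : (choiMatrix d Φ).trace = ∑ i, (Φ (single i i 1)).trace := by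
    simp only [trace, diag_apply, Fintype.sum_prod_type, choiMatrix_apply]
  simp [hsum, h]

theorem choiMatrix_completelyDepolarizingChannel :
    choiMatrix d (completelyDepolarizingChannel d) = (d : ℝ)⁻¹ • 1 := by
  ext ⟨i, k⟩ ⟨j, l⟩
  rw [choiMatrix_apply]
  by_cases hij : i = j <;> by_cases hkl : k = l <;>
    simp [completelyDepolarizingChannel, completelyMixedState, hij, hkl, trace_single_eq_of_ne]

theorem trace_completelyDepolarizingChannel [NeZero d] (X : Op d) :
    (completelyDepolarizingChannel d X).trace = X.trace := by
  have hX : completelyDepolarizingChannel d X = X.trace • completelyMixedState d := rfl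
  simp [hX, completelyMixedState, trace_smul]

/-- Conjugation `X ↦ U X Uᴴ`. The conjugations by unitaries are the sharp channels, those whose
Choi matrix is a multiple of a rank-one projection. -/
noncomputable def conjugationMap (U : Op d) : Op d →L[ℂ] Op d :=
  (LinearMap.mulRight ℂ Uᴴ ∘ₗ LinearMap.mulLeft ℂ U).toContinuousLinearMap

theorem conjugationMap_apply (U X : Op d) : conjugationMap U X = U * X * Uᴴ :=
  rfl

theorem choiMatrix_conjugationMap (U : Op d) :
    choiMatrix d (conjugationMap U) =
      vecMulVec (fun p => U p.2 p.1) (star fun p => U p.2 p.1) := by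
  ext ⟨i, k⟩ ⟨j, l⟩
  rw [choiMatrix_apply, conjugationMap_apply, single_eq_single_vecMulVec_single, mul_vecMulVec,
    vecMulVec_mul, vecMulVec_apply, vecMulVec_apply]
  simp

theorem trace_conjugationMap {U : Op d} (hU : Uᴴ * U = 1) (X : Op d) :
    (conjugationMap U X).trace = X.trace := by
  rw [conjugationMap_apply, trace_mul_cycle, hU, one_mul]

theorem isScaledResolution_choiMatrix_conjugationMap {ι : Type*} [Fintype ι] {U : ι → Op d}
    (hU : ∀ a, (U a)ᴴ * U a = 1)
    (hsum : ∀ k i l j, ∑ a, U a k i * star (U a l j) = if i = j ∧ k = l then (d : ℂ) else 0) :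
    IsScaledResolution (d : ℝ) fun a => choiMatrix d (conjugationMap (U a)) where
  nonneg a := choiMatrix_conjugationMap (U a) ▸ (posSemidef_vecMulVec_self_star _).nonneg
  mul_self a := by
    have hnorm : (star fun p : Fin d × Fin d => U a p.2 p.1) ⬝ᵥ (fun p => U a p.2 p.1) = d := by
      have htrace : ((U a)ᴴ * U a).trace = d := by rw [hU, trace_one, Fintype.card_fin]
      rw [← htrace]
      simp [dotProduct, Fintype.sum_prod_type, trace, mul_apply]
    rw [choiMatrix_conjugationMap, vecMulVec_mul_vecMulVec, hnorm, vecMulVec_smul,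
      Nat.cast_smul_eq_nsmul, Nat.cast_smul_eq_nsmul]
  sum_eq := by
    ext ⟨i, k⟩ ⟨j, l⟩
    simpa [choiMatrix_conjugationMap, Matrix.sum_apply, vecMulVec_apply, one_apply]
      using hsum k i l j

/-- The traces of all values of `Φ`, as a real-linear function of `Φ`. Trace preservation is the
condition that it takes the value `Matrix.trace`. -/
noncomputable def traceApplyLinearMap (d : ℕ) : (Op d →L[ℂ] Op d) →ₗ[ℝ] Op d → ℂ where
  toFun Φ X := (Φ X).trace
  map_add' Φ Ψ := funext fun X => trace_add (Φ X) (Ψ X)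
  map_smul' r Φ := funext fun X => trace_smul r (Φ X)

theorem quantumChannels_eq_spectrahedron (d : ℕ) :
    quantumChannels d =
      spectrahedron (affineLevelSet (traceApplyLinearMap d) trace) (choiMatrix d) := by
  ext Φ
  rw [mem_quantumChannels_iff]
  exact ⟨fun h => ⟨mem_affineLevelSet.2 (funext h.2), h.1.nonneg⟩,
    fun h => ⟨h.2.posSemidef, congrFun (mem_affineLevelSet.1 h.1)⟩⟩

theorem quantumChannels_boundariness_max {d : ℕ} (hd : 1 ≤ d) :
    IsGreatest (boundariness (quantumChannels d) '' quantumChannels d) (1 / (d : ℝ) ^ 2) ∧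
      {Φ ∈ quantumChannels d | boundariness (quantumChannels d) Φ = 1 / (d : ℝ) ^ 2} =
        {completelyDepolarizingChannel d} := by
  have : NeZero d := ⟨Nat.one_le_iff_ne_zero.1 hd⟩
  have : ContinuousSMul ℝ (Op d →L[ℂ] Op d) := IsScalarTower.continuousSMul ℂ
  obtain ⟨U, hU, hsum⟩ := exists_unitary_basis d
  have hres := isScaledResolution_choiMatrix_conjugationMap hU hsum
  have htr {Φ : Op d →L[ℂ] Op d} (hΦ : Φ ∈ affineLevelSet (traceApplyLinearMap d) trace) :
      (choiMatrix d Φ).trace = d :=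
    trace_choiMatrix (congrFun (mem_affineLevelSet.1 hΦ))
  rw [quantumChannels_eq_spectrahedron]
  refine boundariness_spectrahedron_max choiMatrix_injective ?_ (Nat.cast_pos.2 hd)
    (fun Φ hΦ => ?_) (fun Φ hΦ => ?_) hres (fun a => ⟨?_, hres.nonneg a⟩) ?_
  · simp [ZMod.card, sq]
  · simpa [htr hΦ.1] using le_re_trace_smul_one hΦ.2
  · exact (htr hΦ.1).trans (trace_choiMatrix trace_completelyDepolarizingChannel).symm
  · exact mem_affineLevelSet.2 (funext (trace_conjugationMap (hU a)))
  · rw [choiMatrix_completelyDepolarizingChannel]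
    congr 1
    field_simp

end Channels

theorem mainTheorem4 (d n : ℕ) (hd : 1 ≤ d) (hn : 1 ≤ n) :
    (IsGreatest (boundariness (quantumStates d) '' quantumStates d) (1 / (d : ℝ)) ∧
      {ρ ∈ quantumStates d | boundariness (quantumStates d) ρ = 1 / (d : ℝ)} =
        {completelyMixedState d}) ∧
    (IsGreatest (boundariness (quantumObservables d n) '' quantumObservables d n) (1 / (n : ℝ)) ∧
      {E ∈ quantumObservables d n | boundariness (quantumObservables d n) E = 1 / (n : ℝ)} =
        {uniformTrivialObservable d n}) ∧
    (IsGreatest (boundariness (quantumChannels d) '' quantumChannels d) (1 / (d : ℝ) ^ 2) ∧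
      {Φ ∈ quantumChannels d | boundariness (quantumChannels d) Φ = 1 / (d : ℝ) ^ 2} =
        {completelyDepolarizingChannel d}) :=
  ⟨quantumStates_boundariness_max hd, quantumObservables_boundariness_max hd hn,
    quantumChannels_boundariness_max hd⟩
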